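/- Let $d\ge 0$ and let $X\subset\mathbb R^d$ be a finite set in general position: every non-empty $Q\subset X$ with at most $d+1$ points is affinely independent, and no point of $X\setminus Q$ lies on the smallest circumsphere of $Q$. Let $\gamma=(\gamma_1,\gamma_2)\colon X\to\mathbb R^2$ have injective coordinates $\gamma_1,\gamma_2$. For finite $Z\subset\mathbb R^d$, let $\mathrm{DelT}(Z)$ be the set of non-empty $\sigma\subset Z$ that have a circumsphere with no point of $Z$ inside. For $p\in\mathbb R^2$ put $X_p=\{x\in X:\gamma(x)\le p\}$ (product order). *Conflict pairs.* A pair $(\sigma,x)$ is a conflict pair if for some $p=(p_1,p_2)\in\operatorname{im}\gamma_1\times\operatorname{im}\gamma_2$: $\sigma$ is a $d$-simplex of $\mathrm{DelT}(X_p)$, $x$ lies inside the circumsphere of $\sigma$, and $x\in X_{(p_1^+,p_2)}$ or $x\in X_{(p_1,p_2^+)}$, where $p_i^+$ denotes the element of $\operatorname{im}\gamma_i$ immediately after $p_i$ (an alternative is void if that element does not exist). *Insertions and removals.* Both algorithms below maintain a Delaunay triangulation $T$. Inserting $z$ replaces $T=\mathrm{DelT}(Z)$ by $\mathrm{DelT}(Z\cup\{z\})$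 (Bowyer–Watson) and reports the BW-conflicts $(\sigma,z)$, i.e. those with $\sigma$ a $d$-simplex of $T$ whose circumsphere has $z$ inside; removing $z$ replaces $\mathrm{DelT}(Z)$ by $\mathrm{DelT}(Z\setminus\{z\})$. *The algorithms.* Each starts from $\mathrm{DelT}(\emptyset)$ and processes the vertical lines through the points $\gamma(x)$, $x\in X$, in increasing order of $\gamma_1(x)$. When the line of $x$ is reached, $T=\mathrm{DelT}(W)$ with $W=\{w\in X:\gamma_1(w)<\gamma_1(x)\}$; let $R=\{w\in W:\gamma_2(w)>\gamma_2(x)\}$. - *Non-local algorithm:* remove all points of $R$ from $T$ one by one, then insert the points of $R\cup\{x\}$ in increasing order of $\gamma_2$ and record all BW-conflicts reported. - *Local algorithm:* insert $x$; as long as some point of $R$ is joined to $x$ by an edge of $T$, remove one such point (in arbitrary order); let $Q\subset R$ be the set of points removed. Remove $x$. Then insert the points of $Q\cup\{x\}$ in increasing order of $\gamma_2$, and record those reported BW-conflicts $(\sigma,z)$ with $x\in\sigma\cup\{z\}$. Each algorithm then does the same for the horizontal lines, with the roles of $\gamma_1$ and $\gamma_2$ exchanged. **Proposition.** The local algorithm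 correctly computes all conflict pairs. That is: the removals of the local algorithm on each line always come to an end, whatever their order; both algorithms have complete runs; and for every run of the local algorithm (every choice of the orders of removal), the set of all pairs recorded is exactly the set of conflict pairs. Moreover, for every run of the local and every run of the non-local algorithm, the two sets of recorded pairs coincide, and so do, on each vertical line and on each horizontal line, the sets of pairs first recorded on that line (that is, recorded on it and on no earlier line of the same direction). -/

import Mathlib

namespace LocalDelaunay

/-- Points of `ℝ^d` with the Euclidean distance. -/
abbrev Pt (d : ℕ) : Type := EuclideanSpace ℝ (Fin d)

/-- Families of finite point sets (the simplices), used for the triangulation `T` that the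
algorithms maintain. -/
abbrev Cx (d : ℕ) : Type := Set (Finset (Pt d))

/-- Records: pairs (simplex, point). -/
abbrev Rec (d : ℕ) : Type := Set (Finset (Pt d) × Pt d)

variable {d : ℕ}

/-! ### Spheres, general position, Delaunay triangulations -/

/-- The sphere with center `c` and radius `r ≥ 0` is a circumsphere of `Q`. -/
def IsCircumsphere (c : Pt d) (r : ℝ) (Q : Set (Pt d)) : Prop :=
  0 ≤ r ∧ ∀ q ∈ Q, dist q c = r

/-- No point of `Q` lies inside the sphere with center `c` and radius `r`. -/
def IsEmptySphere (c : Pt d) (r : ℝ) (Q : Set (Pt d)) : Prop :=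
  ∀ q ∈ Q, ¬ dist q c < r

/-- A circumsphere of `Q` of least radius. -/
def IsSmallestCircumsphere (c : Pt d) (r : ℝ) (Q : Set (Pt d)) : Prop :=
  IsCircumsphere c r Q ∧ ∀ (c' : Pt d) (r' : ℝ), IsCircumsphere c' r' Q → r ≤ r'

/-- General position of a finite set `X ⊂ ℝ^d`. -/
def GeneralPosition (X : Finset (Pt d)) : Prop :=
  ∀ Q : Finset (Pt d), Q ⊆ X → Q.Nonempty → Q.card ≤ d + 1 →
    AffineIndependent ℝ (fun q : Q => (q : Pt d)) ∧
    ∀ (c : Pt d) (r : ℝ), IsSmallestCircumsphere c r (Q : Set (Pt d)) →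
      ∀ y ∈ X, y ∉ Q → dist y c ≠ r

/-- The Delaunay triangulation of `Z`: all non-empty finite subsets of `Z` that have a
`Z`-empty circumsphere. -/
def delaunay (Z : Set (Pt d)) : Cx d :=
  {σ | σ.Nonempty ∧ (σ : Set (Pt d)) ⊆ Z ∧
    ∃ (c : Pt d) (r : ℝ), IsCircumsphere c r (σ : Set (Pt d)) ∧ IsEmptySphere c r Z}

/-- The vertices of a complex. -/
def vertices (T : Cx d) : Set (Pt d) := {v | {v} ∈ T}

/-- The neighborhood of `v`: the vertices joined to `v` by an edge, together with `v`. -/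
def neighborhood (v : Pt d) (T : Cx d) : Set (Pt d) :=
  {w | w = v ∨ ∃ e ∈ T, e.card = 2 ∧ v ∈ e ∧ w ∈ e}

/-- The point set underlying a Delaunay triangulation can be read off from it. -/
theorem vertices_delaunay (Z : Set (Pt d)) : vertices (delaunay Z) = Z := by
  ext v
  constructor
  · rintro ⟨-, h, -⟩
    exact h (by simp)
  · intro hv
    refine ⟨by simp, by simpa using hv, v, 0, ⟨le_rfl, by simp⟩, fun q _ => ?_⟩
    exact not_lt.mpr dist_nonneg

/-- The point `z` lies inside the circumsphere of `σ` (only used for `d`-simplices of a point set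
in general position, whose circumsphere is unique). -/
def InsideCircumsphere (σ : Finset (Pt d)) (z : Pt d) : Prop :=
  ∃ (c : Pt d) (r : ℝ), IsCircumsphere c r (σ : Set (Pt d)) ∧ dist z c < r

/-! ### The grid of a bifunction and its conflict pairs

The function `γ` is only ever evaluated at points of `X`. -/

/-- The sublevel set `X_p` for the product order on `ℝ × ℝ`. -/
def sublevel (X : Finset (Pt d)) (γ : Pt d → ℝ × ℝ) (p : ℝ × ℝ) : Set (Pt d) :=
  {x | x ∈ X ∧ (γ x).1 ≤ p.1 ∧ (γ x).2 ≤ p.2}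

def image₁ (X : Finset (Pt d)) (γ : Pt d → ℝ × ℝ) : Set ℝ := (fun x => (γ x).1) '' (X : Set (Pt d))

def image₂ (X : Finset (Pt d)) (γ : Pt d → ℝ × ℝ) : Set ℝ := (fun x => (γ x).2) '' (X : Set (Pt d))

/-- `b` is the element of `A` immediately after `a`. -/
def IsNext (A : Set ℝ) (a b : ℝ) : Prop := IsLeast {t | t ∈ A ∧ a < t} b

/-- `(σ, x)` is a conflict pair at the grid point `p`. -/
def IsConflictPairAt (X : Finset (Pt d)) (γ : Pt d → ℝ × ℝ) (p : ℝ × ℝ)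
    (σ : Finset (Pt d)) (x : Pt d) : Prop :=
  p.1 ∈ image₁ X γ ∧ p.2 ∈ image₂ X γ ∧
  σ ∈ delaunay (sublevel X γ p) ∧ σ.card = d + 1 ∧
  ((∃ b, IsNext (image₁ X γ) p.1 b ∧ x ∈ sublevel X γ (b, p.2)) ∨
    (∃ b, IsNext (image₂ X γ) p.2 b ∧ x ∈ sublevel X γ (p.1, b))) ∧
  InsideCircumsphere σ x

/-- The set of all conflict pairs of `γ`. -/
def conflictPairs (X : Finset (Pt d)) (γ : Pt d → ℝ × ℝ) : Rec d :=
  {c | ∃ p : ℝ × ℝ, IsConflictPairAt X γ p c.1 c.2}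

/-! ### Insertion and removal of points in a Delaunay triangulation -/

/-- The BW-conflicts met when `z` is inserted into the triangulation `T`. -/
def bwConflicts (T : Cx d) (z : Pt d) : Rec d :=
  {c | c.1 ∈ T ∧ c.1.card = d + 1 ∧ InsideCircumsphere c.1 z ∧ c.2 = z}

/-- Result of inserting `z`: from `DelT(Z)`, compute `DelT(Z ∪ {z})`. -/
def insertPoint (T : Cx d) (z : Pt d) : Cx d := delaunay (vertices T ∪ {z})

/-- Result of removing `z`: from `DelT(Z)`, compute `DelT(Z \ {z})`. -/
def removePoint (T : Cx d) (z : Pt d) : Cx d := delaunay (vertices T \ {z})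

/-- Insert the points of a list one after the other. -/
def insertAll (T : Cx d) (l : List (Pt d)) : Cx d := l.foldl insertPoint T

/-- All BW-conflicts met while the points of a list are inserted one after the other. -/
def insertionConflicts : Cx d → List (Pt d) → Rec d
  | _, [] => ∅
  | T, z :: l => bwConflicts T z ∪ insertionConflicts (insertPoint T z) l

/-- The list `l` enumerates the set `S` in strictly increasing order of `f`. -/
def EnumeratesIncreasing (f : Pt d → ℝ) (S : Set (Pt d)) (l : List (Pt d)) : Prop :=
  (∀ y, y ∈ l ↔ y ∈ S) ∧ l.Pairwise (fun a b => f a < f b)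

/-! ### The vertical line through `γ x` -/

/-- `W`: the last sublevel set met before the vertical line through `γ x`. -/
def before (X : Finset (Pt d)) (γ : Pt d → ℝ × ℝ) (x : Pt d) : Set (Pt d) :=
  {w | w ∈ X ∧ (γ w).1 < (γ x).1}

/-- The sublevel set at the grid point immediately below `γ x` (empty if there is none). -/
def below (X : Finset (Pt d)) (γ : Pt d → ℝ × ℝ) (x : Pt d) : Set (Pt d) :=
  {w | w ∈ X ∧ (γ w).1 ≤ (γ x).1 ∧ (γ w).2 < (γ x).2}

/-- `R = W \ X_{γ(x)↓}`. -/
def rest (X : Finset (Pt d)) (γ : Pt d → ℝ × ℝ) (x : Pt d) : Set (Pt d) :=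
  before X γ x \ below X γ x

/-- One removal of the local algorithm: a neighbor `y` of `x` that belongs to `R` is removed. -/
def RemovalStep (R : Set (Pt d)) (x : Pt d) (T : Cx d) (y : Pt d) (T' : Cx d) : Prop :=
  y ∈ R ∧ y ∈ neighborhood x T ∧ T' = removePoint T y

/-- `RemovalPhase R x T l T'`: starting from `T`, neighbors of `x` in `R` are removed, in the order
given by `l`, until `x` has no neighbor in `R`; the resulting triangulation is `T'`. -/
inductive RemovalPhase (R : Set (Pt d)) (x : Pt d) : Cx d → List (Pt d) → Cx d → Prop
  | done (T : Cx d) : (∀ y ∈ R, y ∉ neighborhood x T) → RemovalPhase R x T [] T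
  | step (T T₁ T' : Cx d) (y : Pt d) (l : List (Pt d)) :
      RemovalStep R x T y T₁ → RemovalPhase R x T₁ l T' → RemovalPhase R x T (y :: l) T'

/-- `LocalLine X γ x T C T'`: processing of the line through `γ x` by the local algorithm, which
turns the triangulation `T` into `T'` and records the set `C`. -/
def LocalLine (X : Finset (Pt d)) (γ : Pt d → ℝ × ℝ) (x : Pt d)
    (T : Cx d) (C : Rec d) (T' : Cx d) : Prop :=
  ∃ (removed order : List (Pt d)) (T₁ : Cx d),
    RemovalPhase (rest X γ x) x (insertPoint T x) removed T₁ ∧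
    EnumeratesIncreasing (fun y => (γ y).2) ({y | y ∈ removed} ∪ {x}) order ∧
    C = {c | c ∈ insertionConflicts (removePoint T₁ x) order ∧ (x ∈ c.1 ∨ x = c.2)} ∧
    T' = insertAll (removePoint T₁ x) order

/-- `NonLocalLine X γ x T C T'`: processing of the line through `γ x` by the non-local algorithm:
all points of `R` are removed one by one (in any order), then `x` and the points of `R` are inserted
in increasing `γ₂`-order, and all BW-conflicts are recorded. -/
def NonLocalLine (X : Finset (Pt d)) (γ : Pt d → ℝ × ℝ) (x : Pt d)
    (T : Cx d) (C : Rec d) (T' : Cx d) : Prop :=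
  ∃ removed order : List (Pt d),
    removed.Nodup ∧ (∀ y, y ∈ removed ↔ y ∈ rest X γ x) ∧
    EnumeratesIncreasing (fun y => (γ y).2) (rest X γ x ∪ {x}) order ∧
    C = insertionConflicts (removed.foldl removePoint T) order ∧
    T' = insertAll (removed.foldl removePoint T) order

/-! ### Runs of the algorithms -/

/-- The lines through the points of a list are processed one after the other; the triangulation is
passed on from line to line, and the list of the recorded sets, one for each line, is returned. -/
inductive Sweep (line : Pt d → Cx d → Rec d → Cx d → Prop) :
    Cx d → List (Pt d) → List (Rec d) → Prop
  | nil (T : Cx d) : Sweep line T [] []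
  | cons (T T' : Cx d) (x : Pt d) (C : Rec d) (l : List (Pt d)) (out : List (Rec d)) :
      line x T C T' → Sweep line T' l out → Sweep line T (x :: l) (C :: out)

/-- Runs of the local algorithm along the vertical lines, from left to right, starting from the
empty triangulation. -/
def LocalSweep (X : Finset (Pt d)) (γ : Pt d → ℝ × ℝ) (out : List (Rec d)) : Prop :=
  ∃ l : List (Pt d), EnumeratesIncreasing (fun y => (γ y).1) (X : Set (Pt d)) l ∧
    Sweep (LocalLine X γ) (delaunay ∅) l out

/-- Runs of the non-local algorithm along the vertical lines, from left to right, starting from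
the empty triangulation. -/
def NonLocalSweep (X : Finset (Pt d)) (γ : Pt d → ℝ × ℝ) (out : List (Rec d)) : Prop :=
  ∃ l : List (Pt d), EnumeratesIncreasing (fun y => (γ y).1) (X : Set (Pt d)) l ∧
    Sweep (NonLocalLine X γ) (delaunay ∅) l out

/-- Exchange of the two coordinates of `γ`; it turns horizontal lines into vertical ones. -/
def swapped (γ : Pt d → ℝ × ℝ) : Pt d → ℝ × ℝ := fun x => (γ x).swap

/-- A full run of the local algorithm: `V` and `H` list the sets recorded on the successive
vertical and horizontal lines. -/
def LocalRun (X : Finset (Pt d)) (γ : Pt d → ℝ × ℝ) (V H : List (Rec d)) : Prop :=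
  LocalSweep X γ V ∧ LocalSweep X (swapped γ) H

/-- A full run of the non-local algorithm. -/
def NonLocalRun (X : Finset (Pt d)) (γ : Pt d → ℝ × ℝ) (V H : List (Rec d)) : Prop :=
  NonLocalSweep X γ V ∧ NonLocalSweep X (swapped γ) H

/-- Everything that is recorded in the course of a sweep. -/
def recorded (out : List (Rec d)) : Rec d := {c | ∃ C ∈ out, c ∈ C}

/-- The pairs first recorded on the `i`-th line of a sweep. -/
def firstRecorded (out : List (Rec d)) (i : ℕ) : Rec d :=
  {c | c ∈ out.getD i ∅ ∧ ∀ j < i, c ∉ out.getD j ∅}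

/-- On no line can the removals of the local algorithm go on forever. -/
def RemovalsTerminate (X : Finset (Pt d)) (γ : Pt d → ℝ × ℝ) : Prop :=
  ∀ x ∈ X, ¬ ∃ (T : ℕ → Cx d) (y : ℕ → Pt d), T 0 = delaunay (before X γ x ∪ {x}) ∧
    ∀ n, RemovalStep (rest X γ x) x (T n) (y n) (T (n + 1))

end LocalDelaunay

open LocalDelaunay

/-!
For a line through `x`, let `W` be the set of points before the line, `R` the points of `W` above
`x` and `B` those below. The non-local algorithm inserts `R ∪ {x}` from below into `DelT(B)`, so
the conflicts it records are exactly those of `lineConflicts`, which is phrased directly in terms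
of Delaunay triangulations of sublevel sets (`NonLocalLine.result`). The local algorithm instead
inserts `Q ∪ {x}` into `DelT(B ∪ R')`, where `R' = R \ Q` is the set of points that were not
removed, and keeps the conflicts in which `x` takes part. These are precisely the members of
`lineConflicts` in which `x` takes part (`LocalLine.result`), because `x` has no neighbor in `R'`:

* a vertex of a `d`-simplex in conflict with `x` is a neighbor of `x` after the insertion of `x`
  (`mem_neighborhood_of_inside`), so no point of `R'` is a vertex of a conflict that involves `x`;
* if a ball contains `x` and other points inside, one of those points is a neighbor of `x`
  (`exists_neighbor_inside`), so no point of `R'` is inside the circumsphere of such a conflict.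

Both facts come from shrinking a ball while keeping it tangent at a boundary point, until it
touches the next point (`exists_tangent_ball`). General position enters only through the
uniqueness of the circumsphere of a `d`-simplex (`IsCircumsphere.unique`).

A conflict on the line of `x` in which `x` takes no part already occurs on an earlier line
(`exists_earlier_line`), whereas one in which `x` takes part cannot. Hence the two algorithms
first record the same pairs on each line (`firstRecorded_local_eq`), and so record the same pairs
in total. The union of the sets `lineConflicts` over all lines consists of the conflict pairs
arising at a step in the second coordinate of the grid (`mem_upwardConflicts_iff`); exchanging the
coordinates gives the others.
-/

namespace LocalDelaunay

variable {d : ℕ}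

/-! ### Shrinking balls with a fixed boundary point -/

/-- Shrink the ball around `c` through `x`, keeping it tangent at `x` (so that its center moves from
`c` towards `x`), until the first moment at which no point of `A` is strictly inside. At that moment
some point of `A` is on the boundary sphere, and points outside the original open ball are still
outside the new one. -/
theorem exists_tangent_ball (x c : Pt d) (A : Finset (Pt d)) (hA : A.Nonempty)
    (h : ∀ y ∈ A, y ≠ x ∧ dist y c ≤ dist x c) :
    ∃ y ∈ A, ∃ c' : Pt d, dist y c' = dist x c' ∧ (∀ p ∈ A, dist x c' ≤ dist p c') ∧
      ∀ p, dist x c ≤ dist p c → dist x c' ≤ dist p c' := by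
  have key : ∀ (t : ℝ) (p : Pt d), dist p (x + t • (c - x)) ^ 2 - dist x (x + t • (c - x)) ^ 2 =
      ‖p - x‖ ^ 2 - 2 * t * inner ℝ (p - x) (c - x) := by
    intro t p
    have e₁ : p - (x + t • (c - x)) = (p - x) - t • (c - x) := by abel
    have e₂ : x - (x + t • (c - x)) = -(t • (c - x)) := by abel
    rw [dist_eq_norm, dist_eq_norm, e₁, e₂, norm_neg, norm_sub_sq_real, inner_smul_right]
    ring
  have key_one : ∀ p : Pt d, dist p c ^ 2 - dist x c ^ 2 =
      ‖p - x‖ ^ 2 - 2 * inner ℝ (p - x) (c - x) := by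
    intro p
    have := key 1 p
    simpa using this
  have hle : ∀ (t : ℝ) (p : Pt d), 0 ≤ ‖p - x‖ ^ 2 - 2 * t * inner ℝ (p - x) (c - x) →
      dist x (x + t • (c - x)) ≤ dist p (x + t • (c - x)) := by
    intro t p hp
    refine le_of_sq_le_sq ?_ dist_nonneg
    linarith [key t p]
  have hpos : ∀ p ∈ A, 0 < ‖p - x‖ ^ 2 ∧ ‖p - x‖ ^ 2 ≤ 2 * inner ℝ (p - x) (c - x) := by
    intro p hp
    obtain ⟨hne, hd⟩ := h p hp
    refine ⟨by have := norm_pos_iff.mpr (sub_ne_zero.mpr hne); positivity, ?_⟩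
    have := pow_le_pow_left₀ dist_nonneg hd 2
    linarith [key_one p]
  -- `τ p` is the parameter at which the shrinking sphere passes through `p`.
  obtain ⟨τ, hτ⟩ : ∃ τ : Pt d → ℝ, ∀ p, τ p = ‖p - x‖ ^ 2 / (2 * inner ℝ (p - x) (c - x)) :=
    ⟨_, fun _ => rfl⟩
  have hτmul : ∀ p ∈ A, τ p * (2 * inner ℝ (p - x) (c - x)) = ‖p - x‖ ^ 2 := by
    intro p hp
    have := hpos p hp
    rw [hτ, div_mul_cancel₀]
    linarith
  obtain ⟨y, hy, hmin⟩ := A.exists_min_image τ hA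
  have hy0 : 0 ≤ τ y := by
    rw [hτ]
    have := hpos y hy
    exact div_nonneg this.1.le (by linarith)
  have hy1 : τ y ≤ 1 := by
    have := hpos y hy
    rw [hτ]
    exact div_le_one_of_le₀ this.2 (by linarith)
  refine ⟨y, hy, x + τ y • (c - x), ?_, ?_, ?_⟩
  · refine (sq_eq_sq₀ dist_nonneg dist_nonneg).mp ?_
    linarith [key (τ y) y, hτmul y hy]
  · intro p hp
    apply hle
    have h1 := hτmul p hp
    have h2 := hpos p hp
    have h3 := mul_le_mul_of_nonneg_right (hmin p hp)
      (by linarith : 0 ≤ 2 * inner ℝ (p - x) (c - x))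
    linarith
  · intro p hp
    apply hle
    have h1 := pow_le_pow_left₀ dist_nonneg hp 2
    have h2 := key_one p
    rcases le_total (inner ℝ (p - x) (c - x)) 0 with h3 | h3
    · nlinarith [sq_nonneg ‖p - x‖, mul_nonneg hy0 (neg_nonneg.mpr h3)]
    · nlinarith [mul_le_mul_of_nonneg_right hy1 h3]

/-! ### Delaunay neighbors -/

theorem mem_neighborhood_delaunay {Z : Set (Pt d)} {x y c : Pt d} (hx : x ∈ Z) (hy : y ∈ Z)
    (hne : y ≠ x) (hc : dist y c = dist x c) (he : ∀ p ∈ Z, dist x c ≤ dist p c) :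
    y ∈ neighborhood x (delaunay Z) := by
  classical
  refine Or.inr ⟨{x, y}, ⟨by simp, ?_, c, dist x c, ⟨dist_nonneg, ?_⟩, ?_⟩,
    Finset.card_pair hne.symm, by simp, by simp⟩
  · intro q hq
    simp only [Finset.coe_insert, Finset.coe_singleton, Set.mem_insert_iff,
      Set.mem_singleton_iff] at hq
    rcases hq with rfl | rfl <;> assumption
  · intro q hq
    simp only [Finset.coe_insert, Finset.coe_singleton, Set.mem_insert_iff,
      Set.mem_singleton_iff] at hq
    rcases hq with rfl | rfl
    · rfl
    · exact hc
  · exact fun q hq => not_lt.mpr (he q hq)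

/-- Every vertex of a simplex in conflict with `x` becomes a neighbor of `x` when `x` is inserted:
shrink the empty circumscribed ball, keeping it tangent at the vertex `v`, until it touches `x`. -/
theorem mem_neighborhood_of_inside {Z : Set (Pt d)} {x v c : Pt d} {r : ℝ} (hv : v ∈ Z)
    (hvc : dist v c = r) (hxc : dist x c < r) (he : IsEmptySphere c r Z) :
    v ∈ neighborhood x (delaunay (Z ∪ {x})) := by
  have hne : x ≠ v := by
    rintro rfl
    exact hxc.ne hvc
  obtain ⟨y, hy, c', h1, -, h3⟩ := exists_tangent_ball v c {x} (by simp) (by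
    intro y hy
    rw [Finset.mem_singleton] at hy
    subst hy
    exact ⟨hne, by linarith⟩)
  rw [Finset.mem_singleton] at hy
  subst hy
  refine mem_neighborhood_delaunay (c := c') (by simp) (Or.inl hv) hne.symm h1.symm ?_
  rintro p (hp | rfl)
  · rw [h1]
    exact h3 p (by rw [hvc]; exact not_lt.mp (he p hp))
  · rfl

/-- If a closed ball contains `x` and its interior contains some other point of `Z`, then one of the
points of `Z` in the interior is a Delaunay neighbor of `x`. -/
theorem exists_neighbor_inside {Z : Set (Pt d)} (hZ : Z.Finite) {x y c : Pt d} {r : ℝ}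
    (hxZ : x ∉ Z) (hx : dist x c ≤ r) (hy : y ∈ Z) (hyc : dist y c < r) :
    ∃ y' ∈ Z, dist y' c < r ∧ y' ∈ neighborhood x (delaunay (Z ∪ {x})) := by
  classical
  by_cases hcase : ∃ z ∈ Z, dist z c < dist x c
  · -- Shrink the ball around `c` through `x`, with `x` fixed, until its interior misses `Z`.
    obtain ⟨z, hz, hzc⟩ := hcase
    obtain ⟨y', hy', c', h1, h2, h3⟩ := exists_tangent_ball x c
      (hZ.toFinset.filter fun p => dist p c < dist x c) ⟨z, by simp [hz, hzc]⟩ (by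
        intro p hp
        simp only [Finset.mem_filter, Set.Finite.mem_toFinset] at hp
        exact ⟨fun h => hxZ (h ▸ hp.1), hp.2.le⟩)
    simp only [Finset.mem_filter, Set.Finite.mem_toFinset] at hy' h2
    refine ⟨y', hy'.1, by linarith, mem_neighborhood_delaunay (c := c') (by simp) (Or.inl hy'.1)
      (fun h => hxZ (h ▸ hy'.1)) h1 ?_⟩
    rintro p (hp | rfl)
    · rcases lt_or_ge (dist p c) (dist x c) with h | h
      · exact h2 p ⟨hp, h⟩
      · exact h3 p h
    · rfl
  · -- Here the ball around `c` through the point `z` of `Z` nearest to `c` contains `x`.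
    push Not at hcase
    obtain ⟨z, hz, hmin⟩ := hZ.toFinset.exists_min_image (fun p => dist p c) ⟨y, by simpa using hy⟩
    simp only [Set.Finite.mem_toFinset] at hz hmin
    refine ⟨z, hz, (hmin y hy).trans_lt hyc, ?_⟩
    rcases (hcase z hz).lt_or_eq with h | h
    · exact mem_neighborhood_of_inside hz rfl h fun p hp => not_lt.mpr (hmin p hp)
    · refine mem_neighborhood_delaunay (c := c) (by simp) (Or.inl hz) (fun e => hxZ (e ▸ hz))
        h.symm ?_
      rintro p (hp | rfl)
      · exact hcase p hp
      · rfl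

/-! ### Circumspheres of `d`-simplices -/

theorem IsCircumsphere.unique {X σ : Finset (Pt d)} (hX : GeneralPosition X) (hσ : σ ⊆ X)
    (hcard : σ.card = d + 1) {c c' : Pt d} {r r' : ℝ}
    (h : IsCircumsphere c r (σ : Set (Pt d))) (h' : IsCircumsphere c' r' (σ : Set (Pt d))) :
    c = c' ∧ r = r' := by
  have hne : σ.Nonempty := Finset.card_pos.mp (by omega)
  have hind := (hX σ hσ hne hcard.le).1
  have htop : vectorSpan ℝ (Set.range fun q : σ => (q : Pt d)) = ⊤ :=
    hind.vectorSpan_eq_top_of_card_eq_finrank_add_one (by simp [hcard])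
  obtain ⟨q₀, hq₀⟩ := hne
  have hperp : ∀ q ∈ σ, inner ℝ (q - q₀) (c' - c) = 0 := by
    intro q hq
    have e : ∀ p : Pt d, dist p c ^ 2 - dist p c' ^ 2 =
        2 * inner ℝ p (c' - c) + (‖c‖ ^ 2 - ‖c'‖ ^ 2) := by
      intro p
      rw [dist_eq_norm, dist_eq_norm, norm_sub_sq_real, norm_sub_sq_real, inner_sub_right]
      ring
    have e₁ := e q
    have e₂ := e q₀
    rw [h.2 q hq, h'.2 q hq] at e₁
    rw [h.2 q₀ hq₀, h'.2 q₀ hq₀] at e₂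
    rw [inner_sub_left]
    linarith
  have hmem : c' - c ∈ (vectorSpan ℝ (Set.range fun q : σ => (q : Pt d)))ᗮ := by
    rw [vectorSpan_range_eq_span_range_vsub_right ℝ _ (⟨q₀, hq₀⟩ : σ),
      Submodule.mem_orthogonal]
    intro u hu
    induction hu using Submodule.span_induction with
    | mem u hu =>
      obtain ⟨q, rfl⟩ := hu
      exact hperp q q.2
    | zero => simp
    | add u v _ _ hu hv => rw [inner_add_left, hu, hv, add_zero]
    | smul a u _ hu => rw [inner_smul_left, hu, mul_zero]
  rw [htop, Submodule.top_orthogonal_eq_bot, Submodule.mem_bot, sub_eq_zero] at hmem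
  subst hmem
  exact ⟨rfl, by rw [← h.2 q₀ hq₀, h'.2 q₀ hq₀]⟩

/-- By uniqueness of the circumsphere, a conflict of a `d`-simplex of a Delaunay triangulation is
witnessed by its empty circumsphere. -/
theorem exists_conflict_sphere {X : Finset (Pt d)} (hX : GeneralPosition X) {Z : Set (Pt d)}
    (hZ : Z ⊆ X) {σ : Finset (Pt d)} (hσ : σ ∈ delaunay Z) (hcard : σ.card = d + 1) {z : Pt d}
    (hz : InsideCircumsphere σ z) :
    ∃ (c : Pt d) (r : ℝ), IsCircumsphere c r (σ : Set (Pt d)) ∧ IsEmptySphere c r Z ∧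
      dist z c < r := by
  obtain ⟨-, hsub, c, r, hc, he⟩ := hσ
  obtain ⟨c', r', hc', hz⟩ := hz
  obtain ⟨rfl, rfl⟩ := hc.unique hX (fun q hq => hZ (hsub hq)) hcard hc'
  exact ⟨c, r, hc, he, hz⟩

/-! ### Sequences of insertions and removals -/

theorem insertPoint_delaunay (Z : Set (Pt d)) (z : Pt d) :
    insertPoint (delaunay Z) z = delaunay (Z ∪ {z}) := by
  rw [insertPoint, vertices_delaunay]

theorem removePoint_delaunay (Z : Set (Pt d)) (z : Pt d) :
    removePoint (delaunay Z) z = delaunay (Z \ {z}) := by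
  rw [removePoint, vertices_delaunay]

theorem insertAll_delaunay (l : List (Pt d)) (Z : Set (Pt d)) :
    insertAll (delaunay Z) l = delaunay (Z ∪ {y | y ∈ l}) := by
  induction l generalizing Z with
  | nil => simp [insertAll]
  | cons z l ih =>
    have := ih (Z ∪ {z})
    rw [insertAll] at this ⊢
    rw [List.foldl_cons, insertPoint_delaunay, this]
    congr 1
    ext w
    simp only [Set.mem_union, Set.mem_singleton_iff, Set.mem_ofPred_eq, List.mem_cons]
    tauto

theorem foldl_removePoint_delaunay (l : List (Pt d)) (Z : Set (Pt d)) :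
    l.foldl removePoint (delaunay Z) = delaunay (Z \ {y | y ∈ l}) := by
  induction l generalizing Z with
  | nil => simp
  | cons z l ih =>
    rw [List.foldl_cons, removePoint_delaunay, ih]
    congr 1
    ext w
    simp only [Set.mem_sdiff, Set.mem_singleton_iff, Set.mem_ofPred_eq, List.mem_cons]
    tauto

theorem mem_insertionConflicts (f : Pt d → ℝ) {l : List (Pt d)}
    (hl : l.Pairwise fun a b => f a < f b) (Z : Set (Pt d)) (c : Finset (Pt d) × Pt d) :
    c ∈ insertionConflicts (delaunay Z) l ↔
      c.2 ∈ l ∧ c.1 ∈ delaunay (Z ∪ {s | s ∈ l ∧ f s < f c.2}) ∧ c.1.card = d + 1 ∧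
        InsideCircumsphere c.1 c.2 := by
  induction l generalizing Z with
  | nil => simp [insertionConflicts]
  | cons z l ih =>
    rw [List.pairwise_cons] at hl
    rw [insertionConflicts, insertPoint_delaunay, Set.mem_union, ih hl.2]
    have hz : {s | s ∈ z :: l ∧ f s < f z} = ∅ := by
      ext s
      simp only [List.mem_cons, Set.mem_ofPred_eq, Set.mem_empty_iff_false, iff_false, not_and,
        not_lt]
      rintro (rfl | hs)
      · exact le_rfl
      · exact (hl.1 s hs).le
    have hcons : c.2 ∈ l → Z ∪ {z} ∪ {s | s ∈ l ∧ f s < f c.2} =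
        Z ∪ {s | s ∈ z :: l ∧ f s < f c.2} := by
      intro hc
      have := hl.1 _ hc
      ext s
      simp only [Set.mem_union, Set.mem_singleton_iff, Set.mem_ofPred_eq, List.mem_cons]
      constructor
      · rintro ((h | rfl) | h)
        · exact Or.inl h
        · exact Or.inr ⟨Or.inl rfl, this⟩
        · exact Or.inr ⟨Or.inr h.1, h.2⟩
      · rintro (h | ⟨rfl | h, h'⟩)
        · exact Or.inl (Or.inl h)
        · exact Or.inl (Or.inr rfl)
        · exact Or.inr ⟨h, h'⟩
    constructor
    · rintro (⟨h1, h2, h3, h4⟩ | ⟨h1, h2, h3⟩)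
      · rw [h4, hz, Set.union_empty]
        exact ⟨by simp, h1, h2, h4 ▸ h3⟩
      · rw [hcons h1] at h2
        exact ⟨List.mem_cons_of_mem _ h1, h2, h3⟩
    · rintro ⟨h1, h2, h3, h4⟩
      rcases List.mem_cons.mp h1 with h | h
      · rw [h, hz, Set.union_empty] at h2
        exact Or.inl ⟨h2, h3, h ▸ h4, h⟩
      · rw [← hcons h] at h2
        exact Or.inr ⟨h, h2, h3, h4⟩

theorem EnumeratesIncreasing.exists {f : Pt d → ℝ} {S : Set (Pt d)} (hS : S.Finite)
    (hf : Set.InjOn f S) : ∃ l, EnumeratesIncreasing f S l := by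
  classical
  have : Std.Total fun a b : Pt d => f a ≤ f b := ⟨fun a b => le_total _ _⟩
  have : IsTrans (Pt d) fun a b : Pt d => f a ≤ f b := ⟨fun a b c => le_trans⟩
  have hperm := List.perm_insertionSort (fun a b : Pt d => f a ≤ f b) hS.toFinset.toList
  have hmem : ∀ y, y ∈ hS.toFinset.toList.insertionSort (fun a b => f a ≤ f b) ↔ y ∈ S := by
    intro y
    rw [hperm.mem_iff]
    simp
  refine ⟨_, hmem, ?_⟩
  have hnd := hperm.nodup_iff.mpr hS.toFinset.nodup_toList
  have hle := List.pairwise_insertionSort (fun a b : Pt d => f a ≤ f b) hS.toFinset.toList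
  refine (hle.and hnd).imp_of_mem ?_
  rintro a b ha hb ⟨h1, h2⟩
  exact lt_of_le_of_ne h1 fun h => h2 (hf ((hmem a).mp ha) ((hmem b).mp hb) h)

theorem EnumeratesIncreasing.unique {f : Pt d → ℝ} {S : Set (Pt d)} {l l' : List (Pt d)}
    (h : EnumeratesIncreasing f S l) (h' : EnumeratesIncreasing f S l') : l = l' := by
  have hnd : ∀ {m : List (Pt d)}, m.Pairwise (fun a b => f a < f b) → m.Nodup := fun hm =>
    hm.imp fun hab e => hab.ne (congrArg f e)
  have hperm : l.Perm l' := (List.perm_ext_iff_of_nodup (hnd h.2) (hnd h'.2)).mpr fun a => by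
    rw [h.1, h'.1]
  exact hperm.eq_of_pairwise (fun a b _ _ hab hba => absurd hab hba.not_gt) h.2 h'.2

/-! ### The removals of the local algorithm -/

theorem mem_of_mem_neighborhood {Z : Set (Pt d)} {x y : Pt d}
    (h : y ∈ neighborhood x (delaunay Z)) (hne : y ≠ x) : y ∈ Z := by
  rcases h with h | ⟨e, he, -, -, hy⟩
  · exact absurd h hne
  · exact he.2.1 hy

theorem RemovalPhase.result {R : Set (Pt d)} {x : Pt d} {T T' : Cx d} {l : List (Pt d)}
    (h : RemovalPhase R x T l T') : ∀ Z : Set (Pt d), T = delaunay Z →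
      T' = delaunay (Z \ {y | y ∈ l}) ∧ (∀ y ∈ l, y ∈ R) ∧ ∀ y ∈ R, y ∉ neighborhood x T' := by
  induction h with
  | done T hT =>
    rintro Z rfl
    exact ⟨by simp, by simp, hT⟩
  | step T T₁ T' y l hstep _ ih =>
    rintro Z rfl
    obtain ⟨hy, -, rfl⟩ := hstep
    obtain ⟨h1, h2, h3⟩ := ih _ (removePoint_delaunay Z y)
    refine ⟨?_, ?_, h3⟩
    · rw [h1]
      congr 1
      ext w
      simp only [Set.mem_sdiff, Set.mem_singleton_iff, Set.mem_ofPred_eq, List.mem_cons]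
      tauto
    · intro z hz
      rcases List.mem_cons.mp hz with rfl | hz
      · exact hy
      · exact h2 z hz

theorem RemovalPhase.exists {R : Set (Pt d)} {x : Pt d} (hx : x ∉ R) {Z : Set (Pt d)}
    (hZ : Z.Finite) : ∃ l T', RemovalPhase R x (delaunay Z) l T' := by
  induction hn : Z.ncard using Nat.strong_induction_on generalizing Z with
  | _ n ih =>
    by_cases h : ∃ y ∈ R, y ∈ neighborhood x (delaunay Z)
    · obtain ⟨y, hy, hyn⟩ := h
      have hyZ : y ∈ Z := mem_of_mem_neighborhood hyn fun e => hx (e ▸ hy)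
      obtain ⟨l, T', hl⟩ := ih _ (hn ▸ Set.ncard_sdiff_singleton_lt_of_mem hyZ hZ)
        (hZ.subset Set.sdiff_subset) rfl
      exact ⟨y :: l, T', .step _ _ _ y l ⟨hy, hyn, (removePoint_delaunay Z y).symm⟩ hl⟩
    · push Not at h
      exact ⟨[], _, .done _ h⟩

section Line

variable {X : Finset (Pt d)} {γ : Pt d → ℝ × ℝ}

theorem before_subset (x : Pt d) : before X γ x ⊆ X := fun _ h => h.1

theorem notMem_before (x : Pt d) : x ∉ before X γ x := fun h => lt_irrefl _ h.2

theorem notMem_rest (x : Pt d) : x ∉ rest X γ x := fun h => notMem_before x h.1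

theorem mem_rest_iff {x w : Pt d} :
    w ∈ rest X γ x ↔ w ∈ X ∧ (γ w).1 < (γ x).1 ∧ (γ x).2 ≤ (γ w).2 := by
  simp only [rest, before, below, Set.mem_sdiff, Set.mem_ofPred_eq, not_and, not_lt]
  constructor
  · rintro ⟨⟨h1, h2⟩, h3⟩
    exact ⟨h1, h2, h3 h1 h2.le⟩
  · rintro ⟨h1, h2, h3⟩
    exact ⟨⟨h1, h2⟩, fun _ _ => h3⟩

/-- Each removal deletes a vertex, so the number of vertices bounds the number of removals. -/
theorem removalsTerminate : RemovalsTerminate X γ := by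
  rintro x - ⟨T, y, h0, hstep⟩
  have hbound : ∀ n, T n = delaunay (vertices (T n)) ∧ (vertices (T n)).Finite ∧
      (vertices (T n)).ncard + n ≤ (vertices (T 0)).ncard := by
    intro n
    induction n with
    | zero =>
      refine ⟨by rw [h0, vertices_delaunay], ?_, le_rfl⟩
      rw [h0, vertices_delaunay]
      exact (X.finite_toSet.subset (before_subset x)).union (Set.finite_singleton x)
    | succ n ih =>
      obtain ⟨h1, h2, h3⟩ := ih
      obtain ⟨hy, hyn, hT⟩ := hstep n
      have hmem : y n ∈ vertices (T n) := by
        rw [h1] at hyn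
        exact mem_of_mem_neighborhood hyn fun e => notMem_rest x (e ▸ hy)
      have hv : vertices (T (n + 1)) = vertices (T n) \ {y n} := by
        rw [hT, removePoint, vertices_delaunay]
      refine ⟨by rw [hv, hT, removePoint], hv ▸ h2.subset Set.sdiff_subset, ?_⟩
      have := Set.ncard_sdiff_singleton_lt_of_mem hmem h2
      rw [hv]
      omega
  have := (hbound ((vertices (T 0)).ncard + 1)).2.2
  omega

/-! ### The conflicts recorded on a line -/

/-- The conflicts along the vertical line through `γ x`, above `γ x`: pairs `(σ, z)` such that `z`
lies weakly to the left of the line and weakly above `γ x`, and is in conflict with the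
`d`-simplex `σ` of the Delaunay triangulation of all points weakly to the left of the line and
strictly below `z`. -/
def lineConflicts (X : Finset (Pt d)) (γ : Pt d → ℝ × ℝ) (x : Pt d) : Rec d :=
  {c | c.2 ∈ X ∧ (γ c.2).1 ≤ (γ x).1 ∧ (γ x).2 ≤ (γ c.2).2 ∧
    c.1 ∈ delaunay {w | w ∈ X ∧ (γ w).1 ≤ (γ x).1 ∧ (γ w).2 < (γ c.2).2} ∧
    c.1.card = d + 1 ∧ InsideCircumsphere c.1 c.2}

/-- The conflicts along the vertical line through `γ x` in which `x` takes part. -/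
def localLineConflicts (X : Finset (Pt d)) (γ : Pt d → ℝ × ℝ) (x : Pt d) : Rec d :=
  {c | c ∈ lineConflicts X γ x ∧ (x ∈ c.1 ∨ x = c.2)}

theorem eq_or_mem_before (hγ₁ : Set.InjOn (fun x => (γ x).1) (X : Set (Pt d))) {x w : Pt d}
    (hx : x ∈ X) (hw : w ∈ X) (h : (γ w).1 ≤ (γ x).1) : w = x ∨ w ∈ before X γ x := by
  rcases h.lt_or_eq with h | h
  · exact Or.inr ⟨hw, h⟩
  · exact Or.inl (hγ₁ hw hx h)

theorem NonLocalLine.result (hγ₁ : Set.InjOn (fun x => (γ x).1) (X : Set (Pt d))) {x : Pt d}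
    (hx : x ∈ X) {C : Rec d} {T' : Cx d}
    (h : NonLocalLine X γ x (delaunay (before X γ x)) C T') :
    C = lineConflicts X γ x ∧ T' = delaunay (before X γ x ∪ {x}) := by
  obtain ⟨removed, order, -, hrem, ⟨hord, hinc⟩, rfl, rfl⟩ := h
  have hset : {y | y ∈ removed} = rest X γ x := Set.ext hrem
  have hset' : {y | y ∈ order} = rest X γ x ∪ {x} := Set.ext hord
  rw [foldl_removePoint_delaunay, hset]
  constructor
  · ext c
    rw [mem_insertionConflicts _ hinc, hord]
    have h1 : c.2 ∈ rest X γ x ∪ {x} ↔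
        c.2 ∈ X ∧ (γ c.2).1 ≤ (γ x).1 ∧ (γ x).2 ≤ (γ c.2).2 := by
      rw [Set.mem_union, mem_rest_iff, Set.mem_singleton_iff]
      constructor
      · rintro (⟨h1, h2, h3⟩ | h)
        · exact ⟨h1, h2.le, h3⟩
        · rw [h]
          exact ⟨hx, le_rfl, le_rfl⟩
      · rintro ⟨h1, h2, h3⟩
        rcases eq_or_mem_before hγ₁ hx h1 h2 with h | h
        · exact Or.inr h
        · exact Or.inl ⟨h1, h.2, h3⟩
    have h2 : (γ x).2 ≤ (γ c.2).2 →
        before X γ x \ rest X γ x ∪ {s | s ∈ order ∧ (γ s).2 < (γ c.2).2} =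
          {w | w ∈ X ∧ (γ w).1 ≤ (γ x).1 ∧ (γ w).2 < (γ c.2).2} := by
      intro hc
      ext w
      simp only [Set.mem_union, Set.mem_sdiff, Set.mem_ofPred_eq, hord, mem_rest_iff,
        Set.mem_singleton_iff]
      constructor
      · rintro (⟨⟨h1, h2⟩, h3⟩ | ⟨⟨h1, h2, h3⟩ | rfl, h4⟩)
        · refine ⟨h1, h2.le, ?_⟩
          by_contra! h4
          exact h3 ⟨h1, h2, hc.trans h4⟩
        · exact ⟨h1, h2.le, h4⟩
        · exact ⟨hx, le_rfl, h4⟩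
      · rintro ⟨h1, h2, h3⟩
        rcases eq_or_mem_before hγ₁ hx h1 h2 with rfl | h
        · exact Or.inr ⟨Or.inr rfl, h3⟩
        · by_cases h4 : (γ x).2 ≤ (γ w).2
          · exact Or.inr ⟨Or.inl ⟨h1, h.2, h4⟩, h3⟩
          · exact Or.inl ⟨h, fun h' => h4 h'.2.2⟩
    rw [h1]
    constructor
    · rintro ⟨⟨h3, h4, h5⟩, h6, h7⟩
      rw [h2 h5] at h6
      exact ⟨h3, h4, h5, h6, h7⟩
    · rintro ⟨h3, h4, h5, h6, h7⟩
      rw [← h2 h5] at h6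
      exact ⟨⟨h3, h4, h5⟩, h6, h7⟩
  · rw [insertAll_delaunay, hset', ← Set.union_assoc, Set.sdiff_union_of_subset]
    exact Set.sdiff_subset

/-- When `x` has no neighbor left in `R`, the points of `R` that were not removed cannot be seen in
any conflict involving `x`: a remaining point of `R` that is a vertex of such a conflict, or lies
inside its circumsphere, would yield a neighbor of `x` in `R`. -/
theorem LocalLine.result (hX : GeneralPosition X)
    (hγ₁ : Set.InjOn (fun x => (γ x).1) (X : Set (Pt d))) {x : Pt d}
    (hx : x ∈ X) {C : Rec d} {T' : Cx d}
    (h : LocalLine X γ x (delaunay (before X γ x)) C T') :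
    C = localLineConflicts X γ x ∧ T' = delaunay (before X γ x ∪ {x}) := by
  obtain ⟨removed, order, T₁, hphase, ⟨hord, hinc⟩, rfl, rfl⟩ := h
  obtain ⟨rfl, hQR, hnb⟩ := hphase.result _ (insertPoint_delaunay _ _)
  have hxQ : x ∉ removed := fun h => notMem_rest x (hQR x h)
  -- `Y` is `W` without the removed points; the reinsertions start from its triangulation.
  obtain ⟨Y, hY⟩ : ∃ Y, Y = before X γ x \ {y | y ∈ removed} := ⟨_, rfl⟩
  have hYx : (before X γ x ∪ {x}) \ {y | y ∈ removed} = Y ∪ {x} := by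
    have hdisj : Disjoint {x} {y | y ∈ removed} := Set.disjoint_singleton_left.mpr hxQ
    rw [hY, Set.union_sdiff_distrib, hdisj.sdiff_eq_left]
  have hxY : x ∉ Y := fun h => notMem_before x (hY ▸ h).1
  have hYX : Y ⊆ X := fun w hw => ((hY ▸ hw : w ∈ before X γ x \ _).1).1
  have hYrest : ∀ w ∈ Y, (γ x).2 ≤ (γ w).2 → w ∈ rest X γ x := by
    intro w hw h
    have := hY ▸ hw
    exact mem_rest_iff.mpr ⟨this.1.1, this.1.2, h⟩
  have hrem : (Y ∪ {x}) \ {x} = Y := by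
    rw [Set.union_sdiff_right, Set.sdiff_singleton_eq_self hxY]
  rw [hYx] at hnb ⊢
  rw [removePoint_delaunay, hrem]
  constructor
  · ext c
    simp only [Set.mem_ofPred_eq, localLineConflicts]
    refine and_congr_left fun hxc => ?_
    rw [mem_insertionConflicts _ hinc]
    -- When `c.2` is inserted, `U` is the point set of the non-local algorithm and `Y ∪ P` that of
    -- the local one; they differ by points of `R` that were not removed.
    obtain ⟨U, hU⟩ : ∃ U, U = {w | w ∈ X ∧ (γ w).1 ≤ (γ x).1 ∧ (γ w).2 < (γ c.2).2} := ⟨_, rfl⟩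
    obtain ⟨P, hP⟩ : ∃ P, P = {s | s ∈ order ∧ (γ s).2 < (γ c.2).2} := ⟨_, rfl⟩
    have hPU : P ⊆ U := by
      rw [hP, hU]
      rintro s ⟨hs, hsc⟩
      rcases (hord s).mp hs with h | h
      · have := mem_rest_iff.mp (hQR s h)
        exact ⟨this.1, this.2.1.le, hsc⟩
      · rw [Set.mem_singleton_iff] at h
        subst h
        exact ⟨hx, le_rfl, hsc⟩
    have hUYP : U ⊆ Y ∪ P := by
      rw [hY, hP, hU]
      rintro w ⟨h1, h2, h3⟩
      rcases eq_or_mem_before hγ₁ hx h1 h2 with h | h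
      · exact Or.inr ⟨(hord w).mpr (Or.inr h), h3⟩
      · by_cases hw : w ∈ removed
        · exact Or.inr ⟨(hord w).mpr (Or.inl hw), h3⟩
        · exact Or.inl ⟨h, hw⟩
    have hUX : U ⊆ X := by
      rw [hU]
      exact fun w hw => hw.1
    rw [lineConflicts, Set.mem_ofPred_eq, ← hU, ← hP]
    constructor
    · rintro ⟨h1, h2, h3, h4⟩
      have hc2 : c.2 ∈ X ∧ (γ c.2).1 ≤ (γ x).1 ∧ (γ x).2 ≤ (γ c.2).2 := by
        rcases (hord _).mp h1 with h | h
        · have := mem_rest_iff.mp (hQR _ h)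
          exact ⟨this.1, this.2.1.le, this.2.2⟩
        · rw [Set.mem_singleton_iff] at h
          rw [h]
          exact ⟨hx, le_rfl, le_rfl⟩
      refine ⟨hc2.1, hc2.2.1, hc2.2.2, ?_, h3, h4⟩
      obtain ⟨s, r, hs, he, hin⟩ := exists_conflict_sphere hX
        (Set.union_subset hYX (hPU.trans hUX)) h2 h3 h4
      refine ⟨h2.1, fun v hv => ?_, s, r, hs, fun q hq => he q (hUYP hq)⟩
      rcases h2.2.1 hv with hvY | hvP
      · -- A vertex in `Y` that is not below `c.2` would be a neighbor of `x` in `R`.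
        rw [hU]
        have hvW := (hY ▸ hvY : v ∈ before X γ x \ _).1
        refine ⟨hvW.1, hvW.2.le, ?_⟩
        by_contra! hlt
        refine hnb v (hYrest v hvY (hc2.2.2.trans hlt)) ?_
        rcases hxc with hxc | hxc
        · refine mem_neighborhood_delaunay (c := s) (by simp) (Or.inl hvY)
            (fun e => hxY (e ▸ hvY)) ?_ ?_
          · rw [hs.2 v hv, hs.2 x hxc]
          · rintro p (hp | rfl)
            · rw [hs.2 x hxc]
              exact not_lt.mp (he p (Or.inl hp))
            · rfl
        · exact mem_neighborhood_of_inside hvY (hs.2 v hv) (hxc ▸ hin)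
            fun p hp => he p (Or.inl hp)
      · exact hPU hvP
    · rintro ⟨h1, h2, h3, h4, h5, h6⟩
      obtain ⟨s, r, hs, he, hin⟩ := exists_conflict_sphere hX hUX h4 h5 h6
      have hxs : dist x s ≤ r := by
        rcases hxc with hxc | hxc
        · exact (hs.2 x hxc).le
        · exact (hxc ▸ hin).le
      -- A point of `Y` inside the circumsphere would give a neighbor of `x` inside it, which would
      -- be in `R`, since the other points of `Y` are in `U`.
      have hYe : IsEmptySphere s r Y := by
        intro y hy hys
        obtain ⟨y', hy', hy's, hyn⟩ :=
          exists_neighbor_inside (X.finite_toSet.subset hYX) hxY hxs hy hys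
        refine hnb y' (hYrest y' hy' ?_) hyn
        by_contra! hlt
        have hyW := (hY ▸ hy' : y' ∈ before X γ x \ _).1
        exact he y' (by rw [hU]; exact ⟨hyW.1, hyW.2.le, hlt.trans_le h3⟩) hy's
      refine ⟨(hord _).mpr ?_, ⟨h4.1, h4.2.1.trans hUYP, s, r, hs, ?_⟩, h5, h6⟩
      · rcases eq_or_mem_before hγ₁ hx h1 h2 with h | h
        · exact Or.inr h
        · by_contra hQ
          refine hYe c.2 ?_ hin
          rw [hY]
          exact ⟨h, fun h' => hQ (Or.inl h')⟩
      · rintro q (hq | hq)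
        · exact hYe q hq
        · exact he q (hPU hq)
  · rw [insertAll_delaunay, show {y | y ∈ order} = {y | y ∈ removed} ∪ {x} from Set.ext hord,
      ← Set.union_assoc, hY, Set.sdiff_union_of_subset]
    exact fun y hy => (hQR y hy).1

theorem NonLocalLine.exists (hγ₂ : Set.InjOn (fun x => (γ x).2) (X : Set (Pt d))) {x : Pt d}
    (hx : x ∈ X) (T : Cx d) : ∃ C T', NonLocalLine X γ x T C T' := by
  have hsub : rest X γ x ⊆ X := fun y hy => hy.1.1
  have hfin : (rest X γ x).Finite := X.finite_toSet.subset hsub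
  obtain ⟨order, horder⟩ := EnumeratesIncreasing.exists
    (hfin.union (Set.finite_singleton x))
    (hγ₂.mono (Set.union_subset hsub (Set.singleton_subset_iff.mpr hx)))
  exact ⟨_, _, hfin.toFinset.toList, order, hfin.toFinset.nodup_toList, by simp, horder, rfl, rfl⟩

theorem LocalLine.exists (hγ₂ : Set.InjOn (fun x => (γ x).2) (X : Set (Pt d))) {x : Pt d}
    (hx : x ∈ X) : ∃ C T', LocalLine X γ x (delaunay (before X γ x)) C T' := by
  obtain ⟨removed, T₁, hphase⟩ := RemovalPhase.exists (notMem_rest (X := X) (γ := γ) x)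
    ((X.finite_toSet.subset (before_subset x)).union (Set.finite_singleton x))
  rw [← insertPoint_delaunay] at hphase
  have hQR := (hphase.result _ (insertPoint_delaunay _ _)).2.1
  obtain ⟨order, horder⟩ := EnumeratesIncreasing.exists (f := fun y => (γ y).2)
    (S := {y | y ∈ removed} ∪ {x}) ((List.finite_toSet removed).union (Set.finite_singleton x))
    (hγ₂.mono (Set.union_subset (fun y hy => (hQR y hy).1.1) (Set.singleton_subset_iff.mpr hx)))
  exact ⟨_, _, removed, order, T₁, hphase, horder, rfl, rfl⟩

/-! ### Sweeps -/

/-- In an increasing enumeration, the points preceding `x` are those of `before X γ x`. -/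
theorem eq_before_of_split {x : Pt d} {l : List (Pt d)} {Z : Set (Pt d)}
    (hlt : ∀ w ∈ Z, (γ w).1 < (γ x).1) (hinc : ∀ y ∈ l, (γ x).1 < (γ y).1)
    (hmem : ∀ w, w ∈ X ↔ w ∈ Z ∨ w ∈ x :: l) : Z = before X γ x := by
  ext w
  constructor
  · exact fun hw => ⟨(hmem w).mpr (Or.inl hw), hlt w hw⟩
  · rintro ⟨hw, hlt'⟩
    rcases (hmem w).mp hw with h | h
    · exact h
    · rcases List.mem_cons.mp h with rfl | h
      · exact absurd hlt' (lt_irrefl _)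
      · exact absurd hlt' (hinc w h).not_gt

theorem Sweep.eq_map {line : Pt d → Cx d → Rec d → Cx d → Prop} {F : Pt d → Rec d}
    (hline : ∀ x ∈ X, ∀ C T', line x (delaunay (before X γ x)) C T' →
      C = F x ∧ T' = delaunay (before X γ x ∪ {x}))
    {l : List (Pt d)} (hl : EnumeratesIncreasing (fun y => (γ y).1) (X : Set (Pt d)) l)
    {out : List (Rec d)} (h : Sweep line (delaunay ∅) l out) : out = l.map F := by
  have aux : ∀ (T : Cx d) (l : List (Pt d)) (out : List (Rec d)), Sweep line T l out →
      ∀ Z : Set (Pt d), T = delaunay Z → (l.Pairwise fun a b => (γ a).1 < (γ b).1) →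
        (∀ w ∈ Z, ∀ y ∈ l, (γ w).1 < (γ y).1) → (∀ w, w ∈ X ↔ w ∈ Z ∨ w ∈ l) →
        out = l.map F := by
    intro T l out h
    induction h with
    | nil T => simp
    | cons T T' x C l out hx _ ih =>
      rintro Z rfl hinc hlt hmem
      rw [List.pairwise_cons] at hinc
      obtain rfl := eq_before_of_split (fun w hw => hlt w hw x (by simp)) hinc.1 hmem
      obtain ⟨rfl, rfl⟩ := hline x ((hmem x).mpr (Or.inr (by simp))) _ _ hx
      rw [List.map_cons, ih _ rfl hinc.2]
      · rintro w (hw | rfl) y hy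
        · exact hlt w hw y (List.mem_cons_of_mem _ hy)
        · exact hinc.1 y hy
      · intro w
        rw [hmem, List.mem_cons, Set.mem_union, Set.mem_singleton_iff, or_assoc]
  exact aux _ _ _ h ∅ rfl hl.2 (by simp) (by simpa using fun w => (hl.1 w).symm)

theorem Sweep.exists {line : Pt d → Cx d → Rec d → Cx d → Prop}
    (hex : ∀ x ∈ X, ∃ C, line x (delaunay (before X γ x)) C (delaunay (before X γ x ∪ {x})))
    {l : List (Pt d)} (hl : EnumeratesIncreasing (fun y => (γ y).1) (X : Set (Pt d)) l) :
    ∃ out, Sweep line (delaunay ∅) l out := by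
  have aux : ∀ (l : List (Pt d)) (Z : Set (Pt d)),
      (l.Pairwise fun a b => (γ a).1 < (γ b).1) →
        (∀ w ∈ Z, ∀ y ∈ l, (γ w).1 < (γ y).1) → (∀ w, w ∈ X ↔ w ∈ Z ∨ w ∈ l) →
        ∃ out, Sweep line (delaunay Z) l out := by
    intro l
    induction l with
    | nil => exact fun Z _ _ _ => ⟨[], .nil _⟩
    | cons x l ih =>
      rintro Z hinc hlt hmem
      rw [List.pairwise_cons] at hinc
      obtain rfl := eq_before_of_split (fun w hw => hlt w hw x (by simp)) hinc.1 hmem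
      obtain ⟨C, hC⟩ := hex x ((hmem x).mpr (Or.inr (by simp)))
      obtain ⟨out, hout⟩ := ih (before X γ x ∪ {x}) hinc.2 (by
        rintro w (hw | rfl) y hy
        · exact hlt w hw y (List.mem_cons_of_mem _ hy)
        · exact hinc.1 y hy) (by
        intro w
        rw [hmem, List.mem_cons, Set.mem_union, Set.mem_singleton_iff, or_assoc])
      exact ⟨C :: out, .cons _ _ x C l out hC hout⟩
  exact aux l ∅ hl.2 (by simp) (by simpa using fun w => (hl.1 w).symm)

theorem LocalSweep.eq_map (hX : GeneralPosition X)
    (hγ₁ : Set.InjOn (fun x => (γ x).1) (X : Set (Pt d))) {out : List (Rec d)}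
    (h : LocalSweep X γ out) {l : List (Pt d)}
    (hl : EnumeratesIncreasing (fun y => (γ y).1) (X : Set (Pt d)) l) :
    out = l.map (localLineConflicts X γ) := by
  obtain ⟨l', hl', hs⟩ := h
  obtain rfl := hl.unique hl'
  exact hs.eq_map (fun x hx C T' h => h.result hX hγ₁ hx) hl

theorem NonLocalSweep.eq_map
    (hγ₁ : Set.InjOn (fun x => (γ x).1) (X : Set (Pt d))) {out : List (Rec d)}
    (h : NonLocalSweep X γ out) {l : List (Pt d)}
    (hl : EnumeratesIncreasing (fun y => (γ y).1) (X : Set (Pt d)) l) :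
    out = l.map (lineConflicts X γ) := by
  obtain ⟨l', hl', hs⟩ := h
  obtain rfl := hl.unique hl'
  exact hs.eq_map (fun x hx C T' h => h.result hγ₁ hx) hl

theorem LocalSweep.exists (hX : GeneralPosition X)
    (hγ₁ : Set.InjOn (fun x => (γ x).1) (X : Set (Pt d)))
    (hγ₂ : Set.InjOn (fun x => (γ x).2) (X : Set (Pt d))) : ∃ out, LocalSweep X γ out := by
  obtain ⟨l, hl⟩ := EnumeratesIncreasing.exists X.finite_toSet hγ₁
  obtain ⟨out, hout⟩ := Sweep.exists (line := LocalLine X γ) (fun x hx => by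
    obtain ⟨C, T', h⟩ := LocalLine.exists hγ₂ hx
    exact ⟨C, (h.result hX hγ₁ hx).2 ▸ h⟩) hl
  exact ⟨out, l, hl, hout⟩

theorem NonLocalSweep.exists (hγ₁ : Set.InjOn (fun x => (γ x).1) (X : Set (Pt d)))
    (hγ₂ : Set.InjOn (fun x => (γ x).2) (X : Set (Pt d))) : ∃ out, NonLocalSweep X γ out := by
  obtain ⟨l, hl⟩ := EnumeratesIncreasing.exists X.finite_toSet hγ₁
  obtain ⟨out, hout⟩ := Sweep.exists (line := NonLocalLine X γ) (fun x hx => by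
    obtain ⟨C, T', h⟩ := NonLocalLine.exists hγ₂ hx (delaunay (before X γ x))
    exact ⟨C, (h.result hγ₁ hx).2 ▸ h⟩) hl
  exact ⟨out, l, hl, hout⟩

/-! ### Pairs first recorded on a line -/

theorem mem_firstRecorded_map {F : Pt d → Rec d} {l : List (Pt d)} {i : ℕ}
    {c : Finset (Pt d) × Pt d} : c ∈ firstRecorded (l.map F) i ↔
      ∃ h : i < l.length, c ∈ F l[i] ∧ ∀ (j : ℕ) (hj : j < i), c ∉ F l[j] := by
  have hget : ∀ j (hj : j < l.length), (l.map F).getD j ∅ = F l[j] := by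
    intro j hj
    simp [List.getD_eq_getElem?_getD, hj]
  constructor
  · rintro ⟨h1, h2⟩
    have hi : i < l.length := by
      by_contra! hi
      rw [List.getD_eq_default _ _ (by simpa using hi)] at h1
      exact h1
    refine ⟨hi, hget i hi ▸ h1, fun j hj => ?_⟩
    rw [← hget j (hj.trans hi)]
    exact h2 j hj
  · rintro ⟨hi, h1, h2⟩
    refine ⟨by rwa [hget i hi], fun j hj => ?_⟩
    rw [hget j (hj.trans hi)]
    exact h2 j hj

theorem mem_recorded_iff_firstRecorded {out : List (Rec d)} {c : Finset (Pt d) × Pt d} :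
    c ∈ recorded out ↔ ∃ i, c ∈ firstRecorded out i := by
  classical
  constructor
  · rintro ⟨C, hC, hc⟩
    obtain ⟨i, hi, rfl⟩ := List.getElem_of_mem hC
    have hex : ∃ i, c ∈ out.getD i ∅ := ⟨i, by rwa [List.getD_eq_getElem _ _ hi]⟩
    exact ⟨Nat.find hex, Nat.find_spec hex, fun j hj => Nat.find_min hex hj⟩
  · rintro ⟨i, hi, -⟩
    by_cases h : i < out.length
    · rw [List.getD_eq_getElem _ _ h] at hi
      exact ⟨_, List.getElem_mem h, hi⟩
    · rw [List.getD_eq_default _ _ (not_lt.mp h)] at hi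
      exact absurd hi (Set.notMem_empty c)

/-- A conflict on the line of `x` in which `x` takes no part is also a conflict on an earlier line,
namely that of the last point `x'` before `x` which is not above the inserted point. -/
theorem exists_earlier_line (hγ₁ : Set.InjOn (fun x => (γ x).1) (X : Set (Pt d))) {x : Pt d}
    (hx : x ∈ X) {c : Finset (Pt d) × Pt d} (hc : c ∈ lineConflicts X γ x) (h1 : x ∉ c.1)
    (h2 : x ≠ c.2) : ∃ x' ∈ X, (γ x').1 < (γ x).1 ∧ c ∈ lineConflicts X γ x' := by
  classical
  obtain ⟨hcX, hcx, -, ⟨hne, hsub, s, r, hs, he⟩, hcard, hin⟩ := hc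
  have hcb : (γ c.2).1 < (γ x).1 :=
    ((eq_or_mem_before hγ₁ hx hcX hcx).resolve_left (Ne.symm h2)).2
  obtain ⟨x', hx', hmax⟩ :=
    (X.filter fun w => (γ w).1 < (γ x).1 ∧ (γ w).2 ≤ (γ c.2).2).exists_max_image
      (fun w => (γ w).1) ⟨c.2, by simp [hcX, hcb]⟩
  simp only [Finset.mem_filter] at hx' hmax
  refine ⟨x', hx'.1, hx'.2.1, hcX, hmax _ ⟨hcX, hcb, le_rfl⟩, hx'.2.2,
    ⟨hne, fun v hv => ?_, s, r, hs, fun q hq => he q ?_⟩, hcard, hin⟩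
  · obtain ⟨hv1, hv2, hv3⟩ := hsub hv
    have hvb := ((eq_or_mem_before hγ₁ hx hv1 hv2).resolve_left fun e => h1 (e ▸ hv)).2
    exact ⟨hv1, hmax v ⟨hv1, hvb, hv3.le⟩, hv3⟩
  · exact ⟨hq.1, hq.2.1.trans hx'.2.1.le, hq.2.2⟩

theorem firstRecorded_local_eq (hγ₁ : Set.InjOn (fun x => (γ x).1) (X : Set (Pt d)))
    {l : List (Pt d)} (hl : EnumeratesIncreasing (fun y => (γ y).1) (X : Set (Pt d)) l) (i : ℕ) :
    firstRecorded (l.map (localLineConflicts X γ)) i =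
      firstRecorded (l.map (lineConflicts X γ)) i := by
  have hmono : ∀ (j k : ℕ) (hj : j < l.length) (hk : k < l.length), j < k →
      (γ l[j]).1 < (γ l[k]).1 := fun j k hj hk h => List.pairwise_iff_getElem.mp hl.2 j k hj hk h
  ext c
  rw [mem_firstRecorded_map, mem_firstRecorded_map]
  refine exists_congr fun hi => ?_
  constructor
  · rintro ⟨⟨h1, h2⟩, -⟩
    refine ⟨h1, fun j hj hcj => ?_⟩
    -- `l[i]` takes part in `c`, but the line of `l[j]` only involves points up to `l[j]`.
    have hlt := hmono j i (hj.trans hi) hi hj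
    rcases h2 with h2 | h2
    · exact absurd hlt (hcj.2.2.2.1.2.1 h2).2.1.not_gt
    · exact absurd hlt (h2 ▸ hcj.2.1).not_gt
  · rintro ⟨h1, h2⟩
    refine ⟨⟨h1, ?_⟩, fun j hj hcj => h2 j hj hcj.1⟩
    by_contra! h
    obtain ⟨x', hx', hlt, hc⟩ :=
      exists_earlier_line hγ₁ ((hl.1 _).mp (List.getElem_mem hi)) h1 h.1 h.2
    obtain ⟨j, hj, rfl⟩ := List.getElem_of_mem ((hl.1 x').mpr hx')
    refine h2 j ?_ hc
    by_contra! hij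
    rcases hij.lt_or_eq with hij | rfl
    · exact absurd hlt (hmono i j hi hj hij).not_gt
    · exact lt_irrefl _ hlt

/-! ### Recorded pairs are the conflict pairs -/

/-- The conflict pairs that arise at a step of the grid in the direction of the second
coordinate. -/
def upwardConflicts (X : Finset (Pt d)) (γ : Pt d → ℝ × ℝ) : Rec d :=
  {c | ∃ p : ℝ × ℝ, p.1 ∈ image₁ X γ ∧ p.2 ∈ image₂ X γ ∧
    c.1 ∈ delaunay (sublevel X γ p) ∧ c.1.card = d + 1 ∧
    (∃ b, IsNext (image₂ X γ) p.2 b ∧ c.2 ∈ sublevel X γ (p.1, b)) ∧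
    InsideCircumsphere c.1 c.2}

theorem sublevel_swapped (p : ℝ × ℝ) : sublevel X (swapped γ) p = sublevel X γ p.swap := by
  ext w
  simp only [sublevel, swapped, Set.mem_ofPred_eq, Prod.fst_swap, Prod.snd_swap]
  tauto

theorem conflictPairs_eq_union :
    conflictPairs X γ = upwardConflicts X γ ∪ upwardConflicts X (swapped γ) := by
  have e₁ : image₁ X (swapped γ) = image₂ X γ := rfl
  have e₂ : image₂ X (swapped γ) = image₁ X γ := rfl
  ext c
  constructor
  · rintro ⟨p, h1, h2, h3, h4, ⟨b, hb, hc⟩ | ⟨b, hb, hc⟩, h6⟩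
    · refine Or.inr ⟨p.swap, h2, h1, ?_, h4, ⟨b, hb, ?_⟩, h6⟩
      · rwa [sublevel_swapped, Prod.swap_swap]
      · rwa [sublevel_swapped]
    · exact Or.inl ⟨p, h1, h2, h3, h4, ⟨b, hb, hc⟩, h6⟩
  · rintro (⟨p, h1, h2, h3, h4, ⟨b, hb, hc⟩, h6⟩ | ⟨p, h1, h2, h3, h4, ⟨b, hb, hc⟩, h6⟩)
    · exact ⟨p, h1, h2, h3, h4, Or.inr ⟨b, hb, hc⟩, h6⟩
    · rw [sublevel_swapped] at h3 hc
      exact ⟨p.swap, h2, h1, h3, h4, Or.inl ⟨b, hb, hc⟩, h6⟩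

theorem mem_upwardConflicts_iff (hX : GeneralPosition X) {c : Finset (Pt d) × Pt d} :
    c ∈ upwardConflicts X γ ↔ ∃ x ∈ X, c ∈ lineConflicts X γ x := by
  classical
  constructor
  · rintro ⟨p, -, -, h3, h4, ⟨b, ⟨⟨-, hpb⟩, hmin⟩, hcX, hc1, hc2⟩, h6⟩
    obtain ⟨s, r, hs, he, hin⟩ := exists_conflict_sphere hX (fun w hw => hw.1) h3 h4 h6
    have hpc : p.2 < (γ c.2).2 := by
      by_contra! h
      exact he c.2 ⟨hcX, hc1, h⟩ hin
    have hbc : b ≤ (γ c.2).2 := hmin ⟨⟨c.2, hcX, rfl⟩, hpc⟩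
    -- The line of the last point of the sublevel set of `(p.1, b)`.
    obtain ⟨x, hx, hmax⟩ :=
      (X.filter fun w => (γ w).1 ≤ p.1 ∧ (γ w).2 ≤ (γ c.2).2).exists_max_image
        (fun w => (γ w).1) ⟨c.2, by simpa [hcX] using hc1⟩
    simp only [Finset.mem_filter] at hx hmax
    have hset : {w | w ∈ X ∧ (γ w).1 ≤ (γ x).1 ∧ (γ w).2 < (γ c.2).2} = sublevel X γ p := by
      ext w
      constructor
      · rintro ⟨h1, h2, h3⟩
        refine ⟨h1, h2.trans hx.2.1, ?_⟩
        by_contra! h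
        exact absurd (hmin ⟨⟨w, h1, rfl⟩, h⟩) (h3.trans_le hc2).not_ge
      · rintro ⟨h1, h2, h3⟩
        have hw := h3.trans_lt hpc
        exact ⟨h1, hmax w ⟨h1, h2, hw.le⟩, hw⟩
    exact ⟨x, hx.1, hcX, hmax c.2 ⟨hcX, hc1, le_rfl⟩, hx.2.2, by rwa [hset], h4, h6⟩
  · rintro ⟨x, hx, h1, h2, h3, h4, h5, h6⟩
    -- The level below `c.2` exists because the simplex `c.1` has a vertex.
    obtain ⟨v, hv⟩ := h4.1
    obtain ⟨hv1, -, hv3⟩ := h4.2.1 hv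
    obtain ⟨y, hy, hmax⟩ := (X.filter fun w => (γ w).2 < (γ c.2).2).exists_max_image
      (fun w => (γ w).2) ⟨v, by simp [hv1, hv3]⟩
    simp only [Finset.mem_filter] at hy hmax
    have hset : {w | w ∈ X ∧ (γ w).1 ≤ (γ x).1 ∧ (γ w).2 < (γ c.2).2} =
        sublevel X γ ((γ x).1, (γ y).2) := by
      ext w
      constructor
      · rintro ⟨h1, h2, h3⟩
        exact ⟨h1, h2, hmax w ⟨h1, h3⟩⟩
      · rintro ⟨h1, h2, h3⟩
        exact ⟨h1, h2, lt_of_le_of_lt h3 hy.2⟩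
    rw [hset] at h4
    refine ⟨((γ x).1, (γ y).2), ⟨x, hx, rfl⟩, ⟨y, hy.1, rfl⟩, h4, h5,
      ⟨(γ c.2).2, ⟨⟨⟨c.2, h1, rfl⟩, hy.2⟩, ?_⟩, h1, h2, le_rfl⟩, h6⟩
    rintro t ⟨⟨w, hw, rfl⟩, hlt⟩
    by_contra! h
    exact absurd hlt (hmax w ⟨hw, h⟩).not_gt

/-- Correctness of the local algorithm for one of the two directions of sweep. -/
theorem LocalSweep.correct (hX : GeneralPosition X)
    (hγ₁ : Set.InjOn (fun x => (γ x).1) (X : Set (Pt d))) {V : List (Rec d)}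
    (hV : LocalSweep X γ V) :
    recorded V = upwardConflicts X γ ∧ ∀ V', NonLocalSweep X γ V' →
      ∀ i, firstRecorded V i = firstRecorded V' i := by
  obtain ⟨l, hl⟩ := EnumeratesIncreasing.exists X.finite_toSet hγ₁
  rw [hV.eq_map hX hγ₁ hl]
  constructor
  · ext c
    rw [mem_recorded_iff_firstRecorded]
    simp only [firstRecorded_local_eq hγ₁ hl]
    rw [← mem_recorded_iff_firstRecorded, mem_upwardConflicts_iff hX]
    simp only [recorded, List.mem_map, Set.mem_ofPred_eq]
    constructor
    · rintro ⟨_, ⟨x, hx, rfl⟩, hc⟩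
      exact ⟨x, (hl.1 x).mp hx, hc⟩
    · rintro ⟨x, hx, hc⟩
      exact ⟨_, ⟨x, (hl.1 x).mpr hx, rfl⟩, hc⟩
  · intro V' hV' i
    rw [hV'.eq_map hγ₁ hl, firstRecorded_local_eq hγ₁ hl]

end Line

theorem recorded_eq_of_firstRecorded_eq {V V' : List (Rec d)}
    (h : ∀ i, firstRecorded V i = firstRecorded V' i) : recorded V = recorded V' := by
  ext c
  simp only [mem_recorded_iff_firstRecorded, h]

end LocalDelaunay

open LocalDelaunay

theorem mainTheorem6 (d : ℕ) (X : Finset (Pt d)) (hX : GeneralPosition X)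
    (γ : Pt d → ℝ × ℝ)
    (hγ₁ : Set.InjOn (fun x => (γ x).1) (X : Set (Pt d)))
    (hγ₂ : Set.InjOn (fun x => (γ x).2) (X : Set (Pt d))) :
    RemovalsTerminate X γ ∧ RemovalsTerminate X (swapped γ) ∧
    (∃ V H : List (Rec d), LocalRun X γ V H) ∧
    (∃ V' H' : List (Rec d), NonLocalRun X γ V' H') ∧
    ∀ V H : List (Rec d), LocalRun X γ V H →
      recorded V ∪ recorded H = conflictPairs X γ ∧
      ∀ V' H' : List (Rec d), NonLocalRun X γ V' H' →
        (∀ i : ℕ, firstRecorded V i = firstRecorded V' i) ∧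
        (∀ i : ℕ, firstRecorded H i = firstRecorded H' i) ∧
        recorded V ∪ recorded H = recorded V' ∪ recorded H' := by
  refine ⟨removalsTerminate, removalsTerminate, ?_, ?_, ?_⟩
  · obtain ⟨V, hV⟩ := LocalSweep.exists hX hγ₁ hγ₂
    obtain ⟨H, hH⟩ := LocalSweep.exists (γ := swapped γ) hX hγ₂ hγ₁
    exact ⟨V, H, hV, hH⟩
  · obtain ⟨V, hV⟩ := NonLocalSweep.exists hγ₁ hγ₂
    obtain ⟨H, hH⟩ := NonLocalSweep.exists (γ := swapped γ) hγ₂ hγ₁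
    exact ⟨V, H, hV, hH⟩
  · rintro V H ⟨hV, hH⟩
    obtain ⟨hV1, hV2⟩ := hV.correct hX hγ₁
    obtain ⟨hH1, hH2⟩ := hH.correct hX hγ₂
    refine ⟨by rw [hV1, hH1, conflictPairs_eq_union], ?_⟩
    rintro V' H' ⟨hV', hH'⟩
    exact ⟨hV2 V' hV', hH2 H' hH', by
      rw [recorded_eq_of_firstRecorded_eq (hV2 V' hV'),
        recorded_eq_of_firstRecorded_eq (hH2 H' hH')]⟩
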